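/- Throughout, ${}_2F_3\left[\begin{smallmatrix}u_1,u_2\\ v_1,v_2,v_3\end{smallmatrix}\Big|\,z\right]=\sum_{n\ge0}\frac{(u_1)_n(u_2)_n}{n!\,(v_1)_n(v_2)_n(v_3)_n}z^n$ with $(u)_n=u(u+1)\cdots(u+n-1)$, and $J_\alpha(t)=\sum_{n\ge0}\frac{(-1)^n}{n!\,\Gamma(n+\alpha+1)}(t/2)^{2n+\alpha}$ is the Bessel function of the first kind of real order $\alpha$. **(A)** Let $a>0$, $b>0$, $c>-1$ be real numbers satisfying one of the following conditions: (i) $-1<c\le-\tfrac12$, $\;a\le\min(c+1,\,b+c)$ and $b\ge\tfrac14$; (ii) $c\ge-\tfrac12$, $\;b\ge\tfrac14$, and either $$a\le\min\left(\tfrac12,\;b+\tfrac c2-\tfrac14\right)$$ or $$\tfrac12\le a\le\min\left(c+1,\;b+c,\;b+\tfrac c2+\tfrac14,\;\tfrac b2+\tfrac{3c}4+\tfrac38,\;2b+\tfrac c2-\tfrac14\right).$$ Then $${}_2F_3\left[\begin{matrix}a,\;a+\tfrac12\\ c+1,\;a+b,\;a+b+\tfrac12\end{matrix}\;\Big|\;-x^2\right]\ge0\qquad\text{for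 all }x>0.$$ The inequality is strict for every $x>0$ unless $(a,b,c)=(\tfrac12,1,-\tfrac12)$ or $(a,b,c)=(1,\tfrac12,\tfrac12)$; in these two cases the function vanishes at some $x>0$. **(B)** Let $\alpha>-1$ and let $\lambda,\mu$ be real numbers satisfying one of the following conditions: (i) $-1<\alpha\le-\tfrac12$, $\;\lambda\ge-\tfrac12$ and $-\alpha-1<\mu\le\min(\alpha+1,\,\lambda+\alpha)$; (ii) $\alpha\ge-\tfrac12$, $\;\lambda\ge-\tfrac12$, and either $$-\alpha-1<\mu\le\min\left(-\alpha,\;\lambda-\tfrac12\right)$$ or $$-\alpha\le\mu\le\min\left(\alpha+1,\;\lambda+\alpha,\;\lambda+\tfrac12,\;2\lambda+\tfrac12,\;\tfrac12\left(\lambda+\alpha+\tfrac12\right)\right).$$ Then, for every $x>0$, the integral below converges absolutely and $$\int_0^x(x-t)^\lambda\,t^\mu J_\alpha(t)\,dt\ge0 .$$ The inequality is strict for every $x>0$ unless $(\alpha,\lambda,\mu)=(-\tfrac12,1,\tfrac12)$ or $(\alpha,\lambda,\mu)=(\tfrac12,0,\tfrac12)$. In both exceptional cases, for every $x>0$, the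 integral equals $$\sqrt{\tfrac2\pi}\int_0^x(x-t)\cos t\,dt=\sqrt{\tfrac2\pi}\int_0^x\sin t\,dt=2\sqrt{\tfrac2\pi}\,\sin^2\left(\tfrac x2\right).$$ -/

import Mathlib

noncomputable section

/-- The Pochhammer symbol `(u)_n = u (u + 1) ⋯ (u + n - 1)`, with `(u)_0 = 1`. -/
abbrev poch (u : ℝ) (n : ℕ) : ℝ := (ascPochhammer ℝ n).eval u

/-- The generalized hypergeometric series `₂F₃[u₁, u₂; v₁, v₂, v₃ | z]` with real parameters, at a
real argument `z`. -/
def hypergeometric23 (u₁ u₂ v₁ v₂ v₃ z : ℝ) : ℝ :=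
  ∑' n : ℕ, poch u₁ n * poch u₂ n /
    ((n.factorial : ℝ) * (poch v₁ n * poch v₂ n * poch v₃ n)) * z ^ n

/-- The Bessel function of the first kind of real order `ν`, at a positive argument `x`:
`J_ν(x) = ∑ (-1)ⁿ / (n! Γ(n + ν + 1)) (x / 2)^(2 n + ν)`. -/
def besselJ (ν x : ℝ) : ℝ :=
  ∑' n : ℕ, (-1 : ℝ) ^ n / ((n.factorial : ℝ) * Real.Gamma (n + ν + 1)) *
    (x / 2) ^ (2 * (n : ℝ) + ν)

/-- The integrand `(x - t)^λ t^μ J_α(t)`, for `0 < t < x`. -/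
def besselIntegrand (α lam μ x t : ℝ) : ℝ := (x - t) ^ lam * t ^ μ * besselJ α t

/-- The fractional integral `∫₀ˣ (x - t)^λ t^μ J_α(t) dt`. -/
def besselIntegral (α lam μ x : ℝ) : ℝ := ∫ t in (0 : ℝ)..x, besselIntegrand α lam μ x t

end

open MeasureTheory Filter Topology Set

/-- The coefficients of an entire power series. -/
def EntireCoeff (t : ℕ → ℝ) : Prop := ∀ r : ℝ, 0 ≤ r → Summable fun k => |t k| * r ^ k

/-- The sum of the series `∑ t_k (-y)^k`. -/
noncomputable def altSeries (t : ℕ → ℝ) (y : ℝ) : ℝ := ∑' k, t k * (-y) ^ k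

/-- The series `∑ t_k (-y)^k` is entire, positive at `0` and nonnegative on the positive
half-line. -/
structure AltNonneg (t : ℕ → ℝ) : Prop where
  entire : EntireCoeff t
  zero_pos : 0 < t 0
  nonneg : ∀ y, 0 < y → 0 ≤ altSeries t y

theorem EntireCoeff.of_le {t s : ℕ → ℝ} (ht : EntireCoeff t) (C : ℝ)
    (h : ∀ k, |s k| ≤ C * |t k|) : EntireCoeff s := fun r hr =>
  Summable.of_nonneg_of_le (fun k => by positivity)
    (fun k => by
      have := mul_le_mul_of_nonneg_right (h k) (pow_nonneg hr k)
      rwa [mul_assoc] at this) ((ht r hr).mul_left C)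

theorem EntireCoeff.summable {t : ℕ → ℝ} (ht : EntireCoeff t) (y : ℝ) :
    Summable fun k => t k * (-y) ^ k := by
  refine Summable.of_norm ((ht |y| (abs_nonneg y)).congr fun k => ?_)
  simp

theorem EntireCoeff.continuous {t : ℕ → ℝ} (ht : EntireCoeff t) :
    Continuous (altSeries t) := by
  rw [continuous_iff_continuousAt]
  intro y
  have h : ContinuousOn (altSeries t) (Icc (-(|y| + 1)) (|y| + 1)) := by
    refine continuousOn_tsum (u := fun k => |t k| * (|y| + 1) ^ k) (fun k => by fun_prop)
      (ht _ (by positivity)) fun k x hx => ?_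
    rw [norm_mul, norm_pow, norm_neg, Real.norm_eq_abs, Real.norm_eq_abs]
    gcongr
    exact abs_le.2 hx
  refine h.continuousAt (Icc_mem_nhds ?_ ?_)
  · linarith [neg_abs_le y]
  · linarith [le_abs_self y]

theorem altSeries_zero (t : ℕ → ℝ) : altSeries t 0 = t 0 := by
  rw [altSeries, tsum_eq_single 0]
  · simp
  · intro k hk
    simp [hk]

theorem EntireCoeff.div_add {t : ℕ → ℝ} (ht : EntireCoeff t) {u : ℝ} (hu : 0 < u) :
    EntireCoeff fun k => t k / (u + k) := by
  refine ht.of_le u⁻¹ fun k => ?_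
  rw [abs_div, abs_of_pos (by positivity : (0 : ℝ) < u + k), div_eq_mul_inv, mul_comm]
  gcongr
  simp

theorem hasSum_integral_altSeries {t : ℕ → ℝ} (ht : EntireCoeff t) {u y : ℝ} (hu : 0 < u)
    (hy : 0 < y) :
    HasSum (fun k => t k / (u + k) * (-y) ^ k)
      (∫ σ in (0 : ℝ)..1, σ ^ (u - 1) * altSeries t (σ * y)) := by
  have hint : ∀ k : ℕ, ∫ σ in (0 : ℝ)..1, σ ^ (u + k - 1) = 1 / (u + k) := by
    intro k
    have hk : (0 : ℝ) < u + k := by positivity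
    rw [integral_rpow (Or.inl (by linarith))]
    simp [Real.zero_rpow hk.ne']
  have hI : ∀ k : ℕ, IntervalIntegrable (fun σ : ℝ => σ ^ (u + k - 1)) volume 0 1 := by
    intro k
    have hk : (0 : ℝ) < u + k := by positivity
    exact intervalIntegral.intervalIntegrable_rpow' (by linarith)
  have h := hasSum_integral_of_summable_integral_norm (μ := volume.restrict (Ioc (0 : ℝ) 1))
    (F := fun k σ => t k * (-y) ^ k * σ ^ (u + k - 1)) ?_ ?_
  · rw [intervalIntegral.integral_of_le zero_le_one]
    convert! h using 1
    · ext k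
      rw [integral_const_mul, ← intervalIntegral.integral_of_le zero_le_one, hint]
      ring
    · refine setIntegral_congr_fun measurableSet_Ioc fun σ hσ => ?_
      simp only [altSeries]
      rw [← tsum_mul_left]
      refine tsum_congr fun k => ?_
      rw [show u + k - 1 = (u - 1) + k by ring, Real.rpow_add hσ.1, Real.rpow_natCast,
        show -(σ * y) = (-y) * σ by ring, mul_pow]
      ring
  · intro k
    exact ((intervalIntegrable_iff_integrableOn_Ioc_of_le zero_le_one).1 (hI k)).const_mul _
  · refine Summable.congr ((ht.div_add hu) y hy.le) fun k => ?_
    have : ∫ σ in Ioc (0 : ℝ) 1, ‖t k * (-y) ^ k * σ ^ (u + k - 1)‖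
        = ∫ σ in Ioc (0 : ℝ) 1, |t k| * y ^ k * σ ^ (u + k - 1) := by
      refine setIntegral_congr_fun measurableSet_Ioc fun σ hσ => ?_
      simp only [norm_mul, norm_pow, norm_neg, Real.norm_eq_abs, abs_of_pos hy]
      rw [abs_of_nonneg (Real.rpow_nonneg hσ.1.le _)]
    rw [this, integral_const_mul, ← intervalIntegral.integral_of_le zero_le_one, hint,
      abs_div, abs_of_pos (by positivity : (0 : ℝ) < u + k)]
    ring

theorem AltNonneg.div_add_pos {t : ℕ → ℝ} (ht : AltNonneg t) {u y : ℝ} (hu : 0 < u)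
    (hy : 0 < y) : 0 < altSeries (fun k => t k / (u + k)) y := by
  rw [altSeries, (hasSum_integral_altSeries ht.entire hu hy).tsum_eq]
  have hcont : Continuous fun σ : ℝ => altSeries t (σ * y) :=
    ht.entire.continuous.comp (continuous_id.mul continuous_const)
  have hint : IntervalIntegrable (fun σ : ℝ => σ ^ (u - 1) * altSeries t (σ * y)) volume 0 1 :=
    (intervalIntegral.intervalIntegrable_rpow' (by linarith)).mul_continuousOn hcont.continuousOn
  have hev : ∀ᶠ σ in 𝓝 (0 : ℝ), 0 < altSeries t (σ * y) := by
    refine hcont.continuousAt.eventually (lt_mem_nhds ?_)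
    simpa [altSeries_zero] using ht.zero_pos
  obtain ⟨ε, hε, hball⟩ := Metric.eventually_nhds_iff.1 hev
  have hnn : ∀ᵐ σ ∂volume.restrict (Ioc (0 : ℝ) 1), 0 ≤ σ ^ (u - 1) * altSeries t (σ * y) := by
    refine ae_restrict_of_forall_mem measurableSet_Ioc fun σ hσ => ?_
    exact mul_nonneg (Real.rpow_nonneg hσ.1.le _) (ht.nonneg _ (mul_pos hσ.1 hy))
  rw [intervalIntegral.integral_of_le zero_le_one, integral_pos_iff_support_of_nonneg_ae hnn
    ((intervalIntegrable_iff_integrableOn_Ioc_of_le zero_le_one).1 hint),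
    Measure.restrict_apply₀']
  · refine lt_of_lt_of_le ?_ (measure_mono (s := Ioo (0 : ℝ) (min ε 1)) ?_)
    · rw [Real.volume_Ioo]
      simpa using hε
    · intro σ hσ
      have h1 : σ < ε := hσ.2.trans_le (min_le_left _ _)
      have h2 : σ < 1 := hσ.2.trans_le (min_le_right _ _)
      refine ⟨?_, hσ.1, h2.le⟩
      refine (mul_pos (Real.rpow_pos_of_pos hσ.1 _) (hball ?_)).ne'
      rw [Real.dist_eq, sub_zero, abs_of_pos hσ.1]
      exact h1
  · exact measurableSet_Ioc.nullMeasurableSet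

theorem AltNonneg.div_add {t : ℕ → ℝ} (ht : AltNonneg t) {u : ℝ} (hu : 0 < u) :
    AltNonneg fun k => t k / (u + k) where
  entire := ht.entire.div_add hu
  zero_pos := by simpa using div_pos ht.zero_pos hu
  nonneg _ hy := (ht.div_add_pos hu hy).le

/-- Multiplication of the coefficients by a quotient of quadratics in the index. -/
theorem altSeries_mul_quotient {t : ℕ → ℝ} (ht : EntireCoeff t) {u₁ u₂ v₁ v₂ : ℝ} (hu₁ : 0 < u₁)
    (hu₂ : 0 < u₂) (y : ℝ) :
    altSeries (fun k => t k * ((v₁ + k) * (v₂ + k) / ((u₁ + k) * (u₂ + k)))) y =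
      altSeries t y + (v₁ + v₂ - u₁ - u₂) * altSeries (fun k => t k / (u₂ + k)) y +
        (v₁ - u₁) * (v₂ - u₁) * altSeries (fun k => t k / (u₂ + k) / (u₁ + k)) y := by
  have h0 := ht.summable y
  have h1 := (ht.div_add hu₂).summable y
  have h2 := ((ht.div_add hu₂).div_add hu₁).summable y
  simp only [altSeries]
  rw [← tsum_mul_left, ← tsum_mul_left, ← h0.tsum_add (h1.mul_left _),
    ← (h0.add (h1.mul_left _)).tsum_add (h2.mul_left _)]
  refine tsum_congr fun k => ?_
  have : u₁ + k ≠ 0 := by positivity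
  have : u₂ + k ≠ 0 := by positivity
  field_simp
  ring

theorem EntireCoeff.mul_quotient {t : ℕ → ℝ} (ht : EntireCoeff t) {u₁ u₂ v₁ v₂ : ℝ} (hu₁ : 0 < u₁)
    (hu₂ : 0 < u₂) (hv₁ : 0 < v₁) (hv₂ : 0 < v₂) :
    EntireCoeff fun k => t k * ((v₁ + k) * (v₂ + k) / ((u₁ + k) * (u₂ + k))) := by
  have key : ∀ u v : ℝ, 0 < u → 0 < v → ∀ k : ℕ, (v + k) / (u + k) ≤ v / u + 1 := by
    intro u v hu hv k
    rw [div_le_iff₀ (by positivity)]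
    have : (v / u + 1) * (u + k) = v + k + (v / u * k + u) := by field_simp; ring
    rw [this]
    have : 0 ≤ v / u * k + u := by positivity
    linarith
  refine ht.of_le ((v₁ / u₁ + 1) * (v₂ / u₂ + 1)) fun k => ?_
  have e : (v₁ + k) * (v₂ + k) / ((u₁ + k) * (u₂ + k)) =
    (v₁ + k) / (u₁ + k) * ((v₂ + k) / (u₂ + k)) := by rw [mul_div_mul_comm]
  rw [e, abs_mul, mul_comm |t k|, abs_of_nonneg (by positivity)]
  gcongr
  · exact key _ _ hu₁ hv₁ k
  · exact key _ _ hu₂ hv₂ k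

theorem AltNonneg.le_mul_quotient {t : ℕ → ℝ} (ht : AltNonneg t) {u₁ u₂ v₁ v₂ : ℝ} (hu₁ : 0 < u₁)
    (hu₂ : 0 < u₂) (h₁ : u₁ ≤ v₁) (h₂ : u₁ ≤ v₂) (h : u₁ + u₂ ≤ v₁ + v₂) {y : ℝ} (hy : 0 < y) :
    altSeries t y ≤ altSeries (fun k => t k * ((v₁ + k) * (v₂ + k) / ((u₁ + k) * (u₂ + k)))) y := by
  rw [altSeries_mul_quotient ht.entire hu₁ hu₂]
  have := mul_nonneg (by linarith : 0 ≤ v₁ + v₂ - u₁ - u₂) (ht.div_add_pos hu₂ hy).le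
  have := mul_nonneg (mul_nonneg (sub_nonneg.2 h₁) (sub_nonneg.2 h₂))
    ((ht.div_add hu₂).div_add_pos hu₁ hy).le
  linarith

theorem AltNonneg.lt_mul_quotient {t : ℕ → ℝ} (ht : AltNonneg t) {u₁ u₂ v₁ v₂ : ℝ} (hu₁ : 0 < u₁)
    (hu₂ : 0 < u₂) (h₁ : u₁ ≤ v₁) (h₂ : u₁ ≤ v₂) (h : u₁ + u₂ ≤ v₁ + v₂)
    (hs : u₁ + u₂ < v₁ + v₂ ∨ (u₁ < v₁ ∧ u₁ < v₂)) {y : ℝ} (hy : 0 < y) :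
    altSeries t y < altSeries (fun k => t k * ((v₁ + k) * (v₂ + k) / ((u₁ + k) * (u₂ + k)))) y := by
  rw [altSeries_mul_quotient ht.entire hu₁ hu₂]
  have p1 := ht.div_add_pos hu₂ hy
  have p2 := (ht.div_add hu₂).div_add_pos hu₁ hy
  have := mul_nonneg (by linarith : 0 ≤ v₁ + v₂ - u₁ - u₂) p1.le
  have := mul_nonneg (mul_nonneg (sub_nonneg.2 h₁) (sub_nonneg.2 h₂)) p2.le
  rcases hs with hs | ⟨hs1, hs2⟩
  · have := mul_pos (by linarith : 0 < v₁ + v₂ - u₁ - u₂) p1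
    linarith
  · have := mul_pos (mul_pos (sub_pos.2 hs1) (sub_pos.2 hs2)) p2
    linarith

theorem AltNonneg.mul_quotient {t : ℕ → ℝ} (ht : AltNonneg t) {u₁ u₂ v₁ v₂ : ℝ} (hu₁ : 0 < u₁)
    (hu₂ : 0 < u₂) (h₁ : u₁ ≤ v₁) (h₂ : u₁ ≤ v₂) (h : u₁ + u₂ ≤ v₁ + v₂) :
    AltNonneg fun k => t k * ((v₁ + k) * (v₂ + k) / ((u₁ + k) * (u₂ + k))) where
  entire := ht.entire.mul_quotient hu₁ hu₂ (by linarith) (by linarith)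
  zero_pos := by
    have : 0 < v₁ := by linarith
    have : 0 < v₂ := by linarith
    have := ht.zero_pos
    simp only [Nat.cast_zero, add_zero]
    positivity
  nonneg _ hy := (ht.nonneg _ hy).trans (ht.le_mul_quotient hu₁ hu₂ h₁ h₂ h hy)

theorem AltNonneg.const_mul {t : ℕ → ℝ} (ht : AltNonneg t) {c : ℝ} (hc : 0 < c) :
    AltNonneg fun k => c * t k where
  entire := ht.entire.of_le c fun k => by rw [abs_mul, abs_of_pos hc]
  zero_pos := mul_pos hc ht.zero_pos
  nonneg y hy := by
    have : altSeries (fun k => c * t k) y = c * altSeries t y := by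
      simp only [altSeries, mul_assoc, tsum_mul_left]
    rw [this]
    exact mul_nonneg hc.le (ht.nonneg y hy)

theorem poch_zero (u : ℝ) : poch u 0 = 1 := by simp [poch]

theorem poch_succ (u : ℝ) (n : ℕ) : poch u (n + 1) = poch u n * (u + n) :=
  ascPochhammer_succ_eval n u

theorem poch_pos {u : ℝ} (hu : 0 < u) (n : ℕ) : 0 < poch u n := ascPochhammer_pos n u hu

theorem poch_add (u : ℝ) (m n : ℕ) : poch u (m + n) = poch u m * poch (u + m) n := by
  induction n with
  | zero => simp [poch_zero]
  | succ n ih =>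
    rw [← add_assoc, poch_succ, ih, poch_succ]
    push_cast
    ring

theorem poch_succ_left (u : ℝ) (n : ℕ) : poch u (n + 1) = u * poch (u + 1) n := by
  rw [add_comm, poch_add, poch_succ, poch_zero]
  simp

theorem mul_poch_add_one (u : ℝ) (n : ℕ) : u * poch (u + 1) n = poch u n * (u + n) := by
  rw [← poch_succ_left, poch_succ]

theorem poch_two_mul (u : ℝ) (n : ℕ) :
    poch (2 * u) (2 * n) = 4 ^ n * (poch u n * poch (u + 1 / 2) n) := by
  induction n with
  | zero => simp [poch_zero]
  | succ n ih =>
    rw [show 2 * (n + 1) = 2 * n + 1 + 1 by ring, poch_succ, poch_succ, ih, poch_succ, poch_succ]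
    push_cast
    ring

theorem Gamma_nat_add {c : ℝ} (hc : 0 < c) (n : ℕ) :
    Real.Gamma (n + c) = poch c n * Real.Gamma c := by
  induction n with
  | zero => simp [poch_zero]
  | succ n ih =>
    rw [poch_succ, show ((n + 1 : ℕ) : ℝ) + c = (n + c) + 1 by push_cast; ring,
      Real.Gamma_add_one (by positivity), ih]
    ring

/-- The quotient `(u₁)_k (u₂)_k / ((v₁)_k (v₂)_k)`. -/
noncomputable def pochQuot (u₁ u₂ v₁ v₂ : ℝ) (k : ℕ) : ℝ :=
  poch u₁ k * poch u₂ k / (poch v₁ k * poch v₂ k)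

theorem pochQuot_zero (u₁ u₂ v₁ v₂ : ℝ) : pochQuot u₁ u₂ v₁ v₂ 0 = 1 := by
  simp [pochQuot, poch_zero]

theorem pochQuot_pos {u₁ u₂ v₁ v₂ : ℝ} (hu₁ : 0 < u₁) (hu₂ : 0 < u₂) (hv₁ : 0 < v₁)
    (hv₂ : 0 < v₂) (k : ℕ) : 0 < pochQuot u₁ u₂ v₁ v₂ k := by
  have := poch_pos hu₁ k
  have := poch_pos hu₂ k
  have := poch_pos hv₁ k
  have := poch_pos hv₂ k
  unfold pochQuot
  positivity

/-- Shifting the parameters of a quotient of Pochhammer symbols by one. -/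
theorem pochQuot_add_one {u₁ u₂ v₁ v₂ : ℝ} (hu₁ : 0 < u₁) (hu₂ : 0 < u₂) (hv₁ : 0 < v₁)
    (hv₂ : 0 < v₂) (k : ℕ) :
    pochQuot u₁ u₂ v₁ v₂ k = u₁ * u₂ / (v₁ * v₂) *
      (pochQuot (u₁ + 1) (u₂ + 1) (v₁ + 1) (v₂ + 1) k *
        ((v₁ + k) * (v₂ + k) / ((u₁ + k) * (u₂ + k)))) := by
  have e1 := mul_poch_add_one u₁ k
  have e2 := mul_poch_add_one u₂ k
  have e3 := mul_poch_add_one v₁ k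
  have e4 := mul_poch_add_one v₂ k
  have p3 := (poch_pos hv₁ k).ne'
  have p4 := (poch_pos hv₂ k).ne'
  have q3 := (poch_pos (by linarith : 0 < v₁ + 1) k).ne'
  have q4 := (poch_pos (by linarith : 0 < v₂ + 1) k).ne'
  have d1 : u₁ + k ≠ 0 := by positivity
  have d2 : u₂ + k ≠ 0 := by positivity
  unfold pochQuot
  generalize poch (u₁ + 1) k = P1 at *
  generalize poch (u₂ + 1) k = P2 at *
  generalize poch (v₁ + 1) k = P3 at *
  generalize poch (v₂ + 1) k = P4 at *
  generalize poch u₁ k = Q1 at *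
  generalize poch u₂ k = Q2 at *
  generalize poch v₁ k = Q3 at *
  generalize poch v₂ k = Q4 at *
  rw [div_mul_div_comm, div_mul_div_comm, div_eq_div_iff (by positivity) (by positivity)]
  calc _ = (Q1 * (u₁ + k)) * (Q2 * (u₂ + k)) * ((v₁ * P3) * (v₂ * P4)) := by ring
    _ = (u₁ * P1) * (u₂ * P2) * ((Q3 * (v₁ + k)) * (Q4 * (v₂ + k))) := by rw [e1, e2, e3, e4]
    _ = _ := by ring

theorem tendsto_poch_add_div (u v : ℝ) (k : ℕ) (hu : 0 < u) :
    Tendsto (fun N : ℕ => poch (v + N) k / poch (u + N) k) atTop (𝓝 1) := by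
  induction k with
  | zero => simp [poch_zero]
  | succ k ih =>
    have h : Tendsto (fun N : ℕ => (v + N + k) / (u + N + k)) atTop (𝓝 1) := by
      have h0 : Tendsto (fun N : ℕ => 1 + (v - u) / (u + k + N)) atTop (𝓝 (1 + 0)) :=
        tendsto_const_nhds.add (tendsto_const_nhds.div_atTop
          (tendsto_atTop_add_const_left _ _ tendsto_natCast_atTop_atTop))
      rw [add_zero] at h0
      refine h0.congr fun N => ?_
      have : u + k + N ≠ 0 := by positivity
      have : u + N + k ≠ 0 := by positivity
      field_simp
      ring
    have h2 := ih.mul h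
    rw [one_mul] at h2
    refine h2.congr fun N => ?_
    rw [poch_succ, poch_succ, div_mul_div_comm]

theorem quotient_le_quotient_zero {u₁ u₂ v₁ v₂ : ℝ} (hu₁ : 0 < u₁) (hu₂ : 0 < u₂)
    (h₁ : u₁ ≤ v₁) (h₂ : u₁ ≤ v₂) (h : u₁ + u₂ ≤ v₁ + v₂) (k : ℕ) :
    u₁ * u₂ / (v₁ * v₂) * ((v₁ + k) * (v₂ + k) / ((u₁ + k) * (u₂ + k))) ≤ 1 := by
  have hv₁ : 0 < v₁ := by linarith
  have hv₂ : 0 < v₂ := by linarith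
  rw [div_mul_div_comm, div_le_one (by positivity)]
  have hk : (0 : ℝ) ≤ k := k.cast_nonneg
  have hp : u₁ * u₂ ≤ v₁ * v₂ := by
    nlinarith [mul_nonneg (sub_nonneg.2 h₁) (sub_nonneg.2 h₂)]
  have hs : u₁ * u₂ * (v₁ + v₂) ≤ v₁ * v₂ * (u₁ + u₂) := by
    nlinarith [mul_nonneg (sub_nonneg.2 h₁) (sub_nonneg.2 h₂), mul_nonneg hu₁.le (sub_nonneg.2 h),
      mul_nonneg (mul_nonneg (sub_nonneg.2 h₁) (sub_nonneg.2 h₂)) hu₂.le,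
      mul_nonneg (mul_nonneg (sub_nonneg.2 h₁) (sub_nonneg.2 h₂)) hu₁.le,
      mul_nonneg (mul_nonneg hu₁.le hu₁.le) (sub_nonneg.2 h)]
  nlinarith [mul_le_mul_of_nonneg_right hp (mul_nonneg hk hk), mul_le_mul_of_nonneg_right hs hk]

/-- Dominated limits of nonnegative series are nonnegative. -/
theorem AltNonneg.of_tendsto {t s : ℕ → ℝ} (ht : EntireCoeff t) {q : ℕ → ℕ → ℝ}
    (hq : ∀ N, AltNonneg fun k => t k * q N k) (hb : ∀ N k, |q N k| ≤ 1)
    (hlim : ∀ k, Tendsto (fun N => t k * q N k) atTop (𝓝 (s k))) (hs : 0 < s 0) :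
    AltNonneg s where
  zero_pos := hs
  entire := by
    refine ht.of_le 1 fun k => ?_
    rw [one_mul]
    refine le_of_tendsto (hlim k).abs (Eventually.of_forall fun N => ?_)
    rw [abs_mul]
    exact mul_le_of_le_one_right (abs_nonneg _) (hb N k)
  nonneg y hy := by
    have h : Tendsto (fun N => altSeries (fun k => t k * q N k) y) atTop (𝓝 (altSeries s y)) := by
      refine tendsto_tsum_of_dominated_convergence (bound := fun k => |t k| * y ^ k)
        (ht y hy.le) (fun k => (hlim k).mul_const _) (Eventually.of_forall fun N k => ?_)
      rw [norm_mul, norm_mul, norm_pow, norm_neg, Real.norm_eq_abs, Real.norm_eq_abs,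
        Real.norm_eq_abs, abs_of_pos hy]
      gcongr
      exact mul_le_of_le_one_right (abs_nonneg _) (hb N k)
    exact ge_of_tendsto' h fun N => (hq N).nonneg y hy

theorem AltNonneg.mul_pochQuot_div {t : ℕ → ℝ} (ht : AltNonneg t) {u₁ u₂ v₁ v₂ : ℝ}
    (hu₁ : 0 < u₁) (hu₂ : 0 < u₂) (h₁ : u₁ ≤ v₁) (h₂ : u₁ ≤ v₂) (h : u₁ + u₂ ≤ v₁ + v₂) (N : ℕ) :
    AltNonneg (fun k => t k * (pochQuot u₁ u₂ v₁ v₂ k /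
      pochQuot (u₁ + N) (u₂ + N) (v₁ + N) (v₂ + N) k)) ∧
    ∀ k, |pochQuot u₁ u₂ v₁ v₂ k / pochQuot (u₁ + N) (u₂ + N) (v₁ + N) (v₂ + N) k| ≤ 1 := by
  have hv₁ : 0 < v₁ := by linarith
  have hv₂ : 0 < v₂ := by linarith
  induction N with
  | zero =>
    have e : ∀ k, pochQuot u₁ u₂ v₁ v₂ k / pochQuot (u₁ + (0 : ℕ)) (u₂ + (0 : ℕ)) (v₁ + (0 : ℕ))
        (v₂ + (0 : ℕ)) k = 1 := fun k => by
      simp only [Nat.cast_zero, add_zero]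
      exact div_self (pochQuot_pos hu₁ hu₂ hv₁ hv₂ k).ne'
    simp only [e, mul_one, abs_one, le_refl, implies_true, and_true]
    exact ht
  | succ N ih =>
    have a1 : 0 < u₁ + N := by positivity
    have a2 : 0 < u₂ + N := by positivity
    have b1 : 0 < v₁ + N := by positivity
    have b2 : 0 < v₂ + N := by positivity
    have c1 : u₁ + N ≤ v₁ + N := by linarith
    have c2 : u₁ + N ≤ v₂ + N := by linarith
    have c3 : u₁ + N + (u₂ + N) ≤ v₁ + N + (v₂ + N) := by linarith
    have e : ∀ k, pochQuot u₁ u₂ v₁ v₂ k / pochQuot (u₁ + (N + 1 : ℕ)) (u₂ + (N + 1 : ℕ))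
        (v₁ + (N + 1 : ℕ)) (v₂ + (N + 1 : ℕ)) k =
        pochQuot u₁ u₂ v₁ v₂ k / pochQuot (u₁ + N) (u₂ + N) (v₁ + N) (v₂ + N) k *
        ((u₁ + N) * (u₂ + N) / ((v₁ + N) * (v₂ + N)) *
          ((v₁ + N + k) * (v₂ + N + k) / ((u₁ + N + k) * (u₂ + N + k)))) := fun k => by
      have h1 := pochQuot_add_one a1 a2 b1 b2 k
      have p1 := pochQuot_pos a1 a2 b1 b2 k
      have p2 := pochQuot_pos (by linarith : 0 < u₁ + N + 1) (by linarith : 0 < u₂ + N + 1)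
        (by linarith : 0 < v₁ + N + 1) (by linarith : 0 < v₂ + N + 1) k
      push_cast
      simp only [← add_assoc]
      generalize pochQuot (u₁ + N) (u₂ + N) (v₁ + N) (v₂ + N) k = X at *
      generalize pochQuot (u₁ + N + 1) (u₂ + N + 1) (v₁ + N + 1) (v₂ + N + 1) k = Y at *
      rw [div_mul_eq_mul_div, div_eq_div_iff p2.ne' p1.ne', h1]
      ring
    constructor
    · have := ((ih.1.mul_quotient a1 a2 c1 c2 c3).const_mul
        (by positivity : 0 < (u₁ + N) * (u₂ + N) / ((v₁ + N) * (v₂ + N))))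
      convert this using 2 with k
      rw [e k]
      ring
    · intro k
      rw [e k, abs_mul]
      refine mul_le_one₀ (ih.2 k) (abs_nonneg _) ?_
      rw [abs_of_nonneg (by positivity)]
      exact quotient_le_quotient_zero a1 a2 c1 c2 c3 k

/-- Nonnegativity is preserved when the coefficients are multiplied by a quotient of Pochhammer
symbols whose parameters are weakly majorized. -/
theorem AltNonneg.mul_pochQuot {t : ℕ → ℝ} (ht : AltNonneg t) {u₁ u₂ v₁ v₂ : ℝ}
    (hu₁ : 0 < u₁) (hu₂ : 0 < u₂) (h₁ : u₁ ≤ v₁) (h₂ : u₁ ≤ v₂) (h : u₁ + u₂ ≤ v₁ + v₂) :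
    AltNonneg fun k => t k * pochQuot u₁ u₂ v₁ v₂ k := by
  have hv₁ : 0 < v₁ := by linarith
  have hv₂ : 0 < v₂ := by linarith
  have H := ht.mul_pochQuot_div hu₁ hu₂ h₁ h₂ h
  refine AltNonneg.of_tendsto ht.entire (fun N => (H N).1) (fun N => (H N).2) (fun k => ?_)
    (by simpa [pochQuot_zero] using ht.zero_pos)
  refine Tendsto.const_mul _ ?_
  have h1 := (tendsto_poch_add_div u₁ v₁ k hu₁).mul (tendsto_poch_add_div u₂ v₂ k hu₂)
  have h2 := h1.const_mul (pochQuot u₁ u₂ v₁ v₂ k)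
  rw [one_mul, mul_one] at h2
  refine h2.congr fun N => ?_
  rw [pochQuot.eq_1 (u₁ + N), div_mul_div_comm, div_div_eq_mul_div, ← mul_div_assoc]

/-- The multiplication by a weakly majorized quotient gives a strictly positive function unless the
quotient is trivial. -/
theorem AltNonneg.mul_pochQuot_pos {t : ℕ → ℝ} (ht : AltNonneg t) {u₁ u₂ v₁ v₂ : ℝ}
    (hu₁ : 0 < u₁) (hu₂ : 0 < u₂) (h₁ : u₁ ≤ v₁) (h₂ : u₁ ≤ v₂) (h : u₁ + u₂ ≤ v₁ + v₂)
    (hs : (∀ y, 0 < y → 0 < altSeries t y) ∨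
      ¬((u₁ = v₁ ∧ u₂ = v₂) ∨ (u₁ = v₂ ∧ u₂ = v₁))) {y : ℝ} (hy : 0 < y) :
    0 < altSeries (fun k => t k * pochQuot u₁ u₂ v₁ v₂ k) y := by
  have hv₁ : 0 < v₁ := by linarith
  have hv₂ : 0 < v₂ := by linarith
  by_cases hid : (u₁ = v₁ ∧ u₂ = v₂) ∨ (u₁ = v₂ ∧ u₂ = v₁)
  · have e : ∀ k, pochQuot u₁ u₂ v₁ v₂ k = 1 := fun k => by
      have := (poch_pos hv₁ k).ne'
      have := (poch_pos hv₂ k).ne'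
      unfold pochQuot
      rcases hid with ⟨rfl, rfl⟩ | ⟨rfl, rfl⟩
      · exact div_self (by positivity)
      · rw [mul_comm]
        exact div_self (by positivity)
    simp only [e, mul_one]
    exact (hs.resolve_right (not_not.2 hid)) y hy
  · have hstrict : u₁ + u₂ < v₁ + v₂ ∨ (u₁ < v₁ ∧ u₁ < v₂) := by
      by_contra hc
      push Not at hc
      refine hid ?_
      rcases h₁.eq_or_lt with h1 | h1
      · exact Or.inl ⟨h1, by linarith [hc.1]⟩
      · have := hc.2 h1
        exact Or.inr ⟨by linarith, by linarith [hc.1]⟩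
    have hg := ht.mul_pochQuot (by linarith : 0 < u₁ + 1) (by linarith : 0 < u₂ + 1)
      (by linarith : u₁ + 1 ≤ v₁ + 1) (by linarith : u₁ + 1 ≤ v₂ + 1)
      (by linarith : u₁ + 1 + (u₂ + 1) ≤ v₁ + 1 + (v₂ + 1))
    have hlt := hg.lt_mul_quotient hu₁ hu₂ h₁ h₂ h hstrict hy
    have hpos := (hg.nonneg y hy).trans_lt hlt
    have : altSeries (fun k => t k * pochQuot u₁ u₂ v₁ v₂ k) y = u₁ * u₂ / (v₁ * v₂) *
        altSeries (fun k => t k * pochQuot (u₁ + 1) (u₂ + 1) (v₁ + 1) (v₂ + 1) k *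
          ((v₁ + k) * (v₂ + k) / ((u₁ + k) * (u₂ + k)))) y := by
      simp only [altSeries]
      rw [← tsum_mul_left]
      refine tsum_congr fun k => ?_
      rw [pochQuot_add_one hu₁ hu₂ hv₁ hv₂]
      ring
    rw [this]
    positivity

theorem entireCoeff_of_le_inv_factorial {t : ℕ → ℝ} (M : ℝ)
    (h : ∀ k, |t k| ≤ M ^ k / k.factorial) : EntireCoeff t := fun r hr =>
  Summable.of_nonneg_of_le (fun k => by positivity)
    (fun k => by
      calc |t k| * r ^ k ≤ M ^ k / k.factorial * r ^ k := by gcongr; exact h k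
        _ = (M * r) ^ k / k.factorial := by rw [mul_pow]; ring)
    (Real.summable_pow_div_factorial (M * r))

/-- The coefficients of the normalized Bessel function `₀F₁(c; -y / 4)`. -/
noncomputable def besselCoeff (c : ℝ) (k : ℕ) : ℝ := 1 / (4 ^ k * (k.factorial * poch c k))

theorem pow_min_one_le_poch {c : ℝ} (hc : 0 < c) (k : ℕ) : (min c 1) ^ k ≤ poch c k := by
  induction k with
  | zero => simp [poch_zero]
  | succ k ih =>
    have := poch_pos hc k
    rw [pow_succ, poch_succ]
    have : 0 < min c 1 := lt_min hc one_pos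
    have h2 : min c 1 ≤ c + k := (min_le_left _ _).trans (by simp)
    gcongr

theorem entireCoeff_besselCoeff {c : ℝ} (hc : 0 < c) : EntireCoeff (besselCoeff c) := by
  have hm : 0 < min c 1 := lt_min hc one_pos
  refine entireCoeff_of_le_inv_factorial (1 / (4 * min c 1)) fun k => ?_
  have := poch_pos hc k
  have h := pow_min_one_le_poch hc k
  rw [besselCoeff, abs_of_pos (by positivity), div_pow, one_pow, div_div, mul_pow]
  have : (0 : ℝ) < k.factorial := by positivity
  refine one_div_le_one_div_of_le (by positivity) ?_
  nlinarith [mul_le_mul_of_nonneg_left h (by positivity : (0 : ℝ) ≤ 4 ^ k * k.factorial)]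

theorem choose_eq_poch_div (r : ℝ) (n : ℕ) :
    Ring.choose r n = poch (r - n + 1) n / n.factorial := by
  rw [Ring.choose_eq_smul, ← Polynomial.aeval_eq_smeval, poch, ← descPochhammer_eval_eq_ascPochhammer,
    ← descPochhammer_map (Int.castRingHom ℝ), Polynomial.eval_map, Polynomial.aeval_def,
    smul_eq_mul, div_eq_inv_mul]
  rfl

theorem sum_antidiagonal_inv_poch {c : ℝ} (hc : 0 < c) (k : ℕ) :
    ∑ p ∈ Finset.HasAntidiagonal.antidiagonal k,
      1 / (p.1.factorial * poch c p.1) * (1 / (p.2.factorial * poch c p.2)) =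
      poch (2 * c - 1 + k) k / (k.factorial * (poch c k) ^ 2) := by
  have h := Ring.add_choose_eq k (Commute.all (c + k - 1) (c + k - 1))
  rw [choose_eq_poch_div, show c + k - 1 + (c + k - 1) - k + 1 = 2 * c - 1 + k by ring] at h
  rw [← div_div, h, Finset.sum_div]
  refine Finset.sum_congr rfl fun p hp => ?_
  obtain ⟨i, j⟩ := p
  obtain rfl : i + j = k := Finset.HasAntidiagonal.mem_antidiagonal.1 hp
  have e1 := poch_add c i j
  have e2 := poch_add c j i
  rw [add_comm j i] at e2
  have p1 := (poch_pos hc i).ne'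
  have p2 := (poch_pos hc j).ne'
  have p3 := (poch_pos hc (i + j)).ne'
  rw [choose_eq_poch_div, choose_eq_poch_div]
  simp only
  rw [show c + ((i + j : ℕ) : ℝ) - 1 - i + 1 = c + j by push_cast; ring,
    show c + ((i + j : ℕ) : ℝ) - 1 - j + 1 = c + i by push_cast; ring,
    ← mul_div_cancel_left₀ (poch (c + i) j) p1, ← mul_div_cancel_left₀ (poch (c + j) i) p2,
    ← e1, ← e2]
  field_simp

/-- The coefficients of the square of the normalized Bessel function. -/
theorem sum_antidiagonal_besselCoeff {A : ℝ} (hA : 0 < A) (k : ℕ) :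
    ∑ p ∈ Finset.HasAntidiagonal.antidiagonal k, besselCoeff (A + 1 / 2) p.1 * besselCoeff (A + 1 / 2) p.2 =
      poch A k / (k.factorial * (poch (A + 1 / 2) k * poch (2 * A) k)) := by
  have h := sum_antidiagonal_inv_poch (by linarith : 0 < A + 1 / 2) k
  have e : ∀ p ∈ Finset.HasAntidiagonal.antidiagonal k,
      besselCoeff (A + 1 / 2) p.1 * besselCoeff (A + 1 / 2) p.2 =
      1 / 4 ^ k * (1 / (p.1.factorial * poch (A + 1 / 2) p.1) *
        (1 / (p.2.factorial * poch (A + 1 / 2) p.2))) := by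
    rintro ⟨i, j⟩ hp
    obtain rfl : i + j = k := Finset.HasAntidiagonal.mem_antidiagonal.1 hp
    simp only [besselCoeff, pow_add]
    generalize poch (A + 1 / 2) i = X
    generalize poch (A + 1 / 2) j = Y
    rw [div_mul_div_comm, div_mul_div_comm, div_mul_div_comm]
    congr 1
    · ring
    · ring
  rw [Finset.sum_congr rfl e, ← Finset.mul_sum, h, show 2 * (A + 1 / 2) - 1 = 2 * A by ring]
  have h2 := poch_add (2 * A) k k
  rw [← two_mul, poch_two_mul] at h2
  have p1 := (poch_pos (by linarith : 0 < 2 * A) k).ne'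
  have p2 := (poch_pos (by linarith : 0 < A + 1 / 2) k).ne'
  rw [div_mul_div_comm, div_eq_div_iff (by positivity) (by positivity)]
  linear_combination (-(k.factorial : ℝ) * poch (A + 1 / 2) k) * h2

theorem summable_norm_besselCoeff {c : ℝ} (hc : 0 < c) (y : ℝ) :
    Summable fun k => ‖besselCoeff c k * (-y) ^ k‖ := by
  refine (entireCoeff_besselCoeff hc |y| (abs_nonneg y)).congr fun k => ?_
  simp

/-- The square of a Bessel function as a `₁F₂` series. -/
theorem altSeries_eq_sq {A : ℝ} (hA : 0 < A) (y : ℝ) :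
    altSeries (fun k => poch A k / (k.factorial * (poch (A + 1 / 2) k * poch (2 * A) k))) y =
      altSeries (besselCoeff (A + 1 / 2)) y ^ 2 := by
  have hs := summable_norm_besselCoeff (by linarith : 0 < A + 1 / 2) y
  rw [sq, altSeries, altSeries, tsum_mul_tsum_eq_tsum_sum_antidiagonal_of_summable_norm hs hs]
  refine tsum_congr fun k => ?_
  rw [← sum_antidiagonal_besselCoeff hA, Finset.sum_mul]
  refine Finset.sum_congr rfl fun p hp => ?_
  rw [← Finset.HasAntidiagonal.mem_antidiagonal.1 hp, pow_add]
  ring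

theorem entireCoeff_oneFTwo {A B C : ℝ} (hA : 0 < A) (hB : 0 < B) (hC : 0 < C) (hAB : A ≤ B) :
    EntireCoeff fun k => poch A k / (k.factorial * (poch B k * poch C k)) := by
  have hm : 0 < min C 1 := lt_min hC one_pos
  refine entireCoeff_of_le_inv_factorial (1 / min C 1) fun k => ?_
  have pA := poch_pos hA k
  have pB := poch_pos hB k
  have pC := poch_pos hC k
  have h := pow_min_one_le_poch hC k
  have hle : poch A k ≤ poch B k := by
    clear pA pB pC h
    induction k with
    | zero => simp [poch_zero]
    | succ k ih =>
      rw [poch_succ, poch_succ]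
      have := poch_pos hA k
      gcongr
      exact (poch_pos hB k).le
  rw [abs_of_pos (by positivity), div_pow, one_pow, div_div,
    div_le_div_iff₀ (by positivity) (by positivity), one_mul]
  have : (0 : ℝ) < k.factorial := by positivity
  calc poch A k * ((min C 1) ^ k * k.factorial) ≤ poch B k * (poch C k * k.factorial) := by gcongr
    _ = _ := by ring

theorem altNonneg_sq {A : ℝ} (hA : 0 < A) :
    AltNonneg fun k => poch A k / (k.factorial * (poch (A + 1 / 2) k * poch (2 * A) k)) where
  entire := entireCoeff_oneFTwo hA (by linarith) (by linarith) (by linarith)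
  zero_pos := by simp [poch_zero]
  nonneg y _ := by
    rw [altSeries_eq_sq hA]
    positivity

/-- The coefficients of the series `₂F₃[a, a + 1/2; c + 1, a + b, a + b + 1/2 | -y]`. -/
noncomputable def twoFThreeCoeff (a b c : ℝ) (k : ℕ) : ℝ :=
  poch a k * poch (a + 1 / 2) k /
    ((k.factorial : ℝ) * (poch (c + 1) k * poch (a + b) k * poch (a + b + 1 / 2) k))

theorem hypergeometric23_eq_altSeries (a b c x : ℝ) :
    hypergeometric23 a (a + 1 / 2) (c + 1) (a + b) (a + b + 1 / 2) (-x ^ 2) =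
      altSeries (twoFThreeCoeff a b c) (x ^ 2) := rfl

/-- Two successive weak majorizations, starting from the square of a Bessel function. -/
theorem altNonneg_of_two_steps {s : ℕ → ℝ} {A u₁ u₂ v₁ v₂ p₁ p₂ q₁ q₂ : ℝ} (hA : 0 < A)
    (hu₁ : 0 < u₁) (hu₂ : 0 < u₂) (h₁ : u₁ ≤ v₁) (h₂ : u₁ ≤ v₂) (h : u₁ + u₂ ≤ v₁ + v₂)
    (hp₁ : 0 < p₁) (hp₂ : 0 < p₂) (k₁ : p₁ ≤ q₁) (k₂ : p₁ ≤ q₂) (k : p₁ + p₂ ≤ q₁ + q₂)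
    (hs : ∀ n, s n = poch A n / (n.factorial * (poch (A + 1 / 2) n * poch (2 * A) n)) *
      pochQuot u₁ u₂ v₁ v₂ n * pochQuot p₁ p₂ q₁ q₂ n) :
    AltNonneg s ∧ (¬(((u₁ = v₁ ∧ u₂ = v₂) ∨ (u₁ = v₂ ∧ u₂ = v₁)) ∧
      ((p₁ = q₁ ∧ p₂ = q₂) ∨ (p₁ = q₂ ∧ p₂ = q₁))) → ∀ y, 0 < y → 0 < altSeries s y) := by
  obtain rfl : s = _ := funext hs
  have a1 := (altNonneg_sq hA).mul_pochQuot hu₁ hu₂ h₁ h₂ h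
  refine ⟨a1.mul_pochQuot hp₁ hp₂ k₁ k₂ k, fun hne y hy => ?_⟩
  refine a1.mul_pochQuot_pos hp₁ hp₂ k₁ k₂ k ?_ hy
  rw [not_and_or] at hne
  exact hne.imp_left fun hn y hy =>
    (altNonneg_sq hA).mul_pochQuot_pos hu₁ hu₂ h₁ h₂ h (Or.inr hn) hy

/-- The two exceptional parameter triples. -/
def IsExceptional (a b c : ℝ) : Prop :=
  (a = 1 / 2 ∧ b = 1 ∧ c = -1 / 2) ∨ (a = 1 ∧ b = 1 / 2 ∧ c = 1 / 2)

/-- Nonnegativity of the series, with strict positivity outside the exceptional cases. -/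
def TwoFThreePositive (a b c : ℝ) : Prop :=
  AltNonneg (twoFThreeCoeff a b c) ∧
    (¬IsExceptional a b c → ∀ y, 0 < y → 0 < altSeries (twoFThreeCoeff a b c) y)

theorem TwoFThreePositive.mono {a b b' c : ℝ} (ha : 0 < a) (hb : 0 < b) (hlt : b < b')
    (h : AltNonneg (twoFThreeCoeff a b c)) : TwoFThreePositive a b' c := by
  have e : twoFThreeCoeff a b' c = fun k => twoFThreeCoeff a b c k *
      pochQuot (a + b) (a + b + 1 / 2) (a + b') (a + b' + 1 / 2) k := by
    funext k
    have p1 := (poch_pos (by linarith : 0 < a + b) k).ne'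
    have p2 := (poch_pos (by linarith : 0 < a + b + 1 / 2) k).ne'
    unfold twoFThreeCoeff pochQuot
    generalize poch (a + b) k = X at *
    generalize poch (a + b + 1 / 2) k = Y at *
    rw [div_mul_div_comm, ← mul_div_mul_right _ _ (mul_ne_zero p1 p2)]
    congr 1
    ring
  have hx : 0 < a + b := by linarith
  have hy : 0 < a + b + 1 / 2 := by linarith
  unfold TwoFThreePositive
  rw [e]
  refine ⟨h.mul_pochQuot hx hy (by linarith) (by linarith) (by linarith), fun _ y hy' => ?_⟩
  refine h.mul_pochQuot_pos hx hy (by linarith) (by linarith) (by linarith) (Or.inr ?_) hy'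
  rintro (⟨h1, -⟩ | ⟨h1, -⟩) <;> linarith

theorem twoFThreePositive_of_le_one {a b c : ℝ} (ha : 0 < a) (hb : 1 / 4 ≤ b) (hb1 : b ≤ 1)
    (h2 : a ≤ b + c) (h3 : a ≤ b + c / 2 - 1 / 4) :
    TwoFThreePositive a b c := by
  have H := altNonneg_of_two_steps (s := twoFThreeCoeff a b c) (A := a + 1 / 2) (u₁ := a)
    (u₂ := a + 1) (v₁ := a + b) (v₂ := a + 1 - b) (p₁ := a + 1 - b) (p₂ := 2 * a + 1)
    (q₁ := c + 1) (q₂ := a + b + 1 / 2) (by linarith) (by linarith) (by linarith) (by linarith)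
    (by linarith) (by linarith) (by linarith) (by linarith) (by linarith) (by linarith)
    (by linarith) fun k => by
      rw [show a + 1 / 2 + 1 / 2 = a + 1 by ring, show 2 * (a + 1 / 2) = 2 * a + 1 by ring]
      unfold twoFThreeCoeff pochQuot
      have p1 := (poch_pos (by linarith : 0 < a + 1) k).ne'
      have p2 := (poch_pos (by linarith : 0 < 2 * a + 1) k).ne'
      have p3 := (poch_pos (by linarith : 0 < a + 1 - b) k).ne'
      generalize poch (a + 1) k = X at *
      generalize poch (2 * a + 1) k = Y at *
      generalize poch (a + 1 - b) k = Z at *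
      rw [div_mul_div_comm, div_mul_div_comm,
        ← mul_div_mul_right _ _ (mul_ne_zero (mul_ne_zero p1 p2) p3)]
      congr 1 <;> ring
  refine ⟨H.1, fun hn => H.2 fun ⟨i1, i2⟩ => hn (Or.inl ?_)⟩
  rcases i1 with ⟨i1, -⟩ | ⟨i1, -⟩
  · linarith
  · rcases i2 with ⟨i2, i3⟩ | ⟨i2, i3⟩
    · exact ⟨by linarith, by linarith, by linarith⟩
    · linarith

theorem twoFThreePositive_of_b_le_half {a b c : ℝ} (ha : 1 / 2 ≤ a) (hb : 1 / 4 ≤ b)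
    (hb1 : b ≤ 1 / 2) (h2 : a ≤ b + c) (h3 : a ≤ 2 * b + c / 2 - 1 / 4) :
    TwoFThreePositive a b c := by
  have H := altNonneg_of_two_steps (s := twoFThreeCoeff a b c) (A := a + 1 / 2 - b)
    (u₁ := a + 1 - b) (u₂ := 2 * a + 1 - 2 * b) (v₁ := a + b + 1 / 2) (v₂ := c + 1) (p₁ := a)
    (p₂ := a + 1 / 2) (q₁ := a + 1 / 2 - b) (q₂ := a + b) (by linarith) (by linarith) (by linarith)
    (by linarith) (by linarith) (by linarith) (by linarith) (by linarith) (by linarith)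
    (by linarith) (by linarith) fun k => by
      rw [show a + 1 / 2 - b + 1 / 2 = a + 1 - b by ring,
        show 2 * (a + 1 / 2 - b) = 2 * a + 1 - 2 * b by ring]
      unfold twoFThreeCoeff pochQuot
      have p1 := (poch_pos (by linarith : 0 < a + 1 - b) k).ne'
      have p2 := (poch_pos (by linarith : 0 < 2 * a + 1 - 2 * b) k).ne'
      have p3 := (poch_pos (by linarith : 0 < a + 1 / 2 - b) k).ne'
      generalize poch (a + 1 - b) k = X at *
      generalize poch (2 * a + 1 - 2 * b) k = Y at *
      generalize poch (a + 1 / 2 - b) k = Z at *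
      rw [div_mul_div_comm, div_mul_div_comm,
        ← mul_div_mul_right _ _ (mul_ne_zero (mul_ne_zero p1 p2) p3)]
      congr 1 <;> ring
  refine ⟨H.1, fun hn => H.2 fun ⟨i1, i2⟩ => hn (Or.inr ?_)⟩
  rcases i2 with ⟨i2, i3⟩ | ⟨i2, i3⟩
  · rcases i1 with ⟨i1, i4⟩ | ⟨i1, i4⟩
    · linarith
    · exact ⟨by linarith, by linarith, by linarith⟩
  · linarith

theorem twoFThreePositive_of_half_le {a b c : ℝ} (ha : 1 / 2 ≤ a) (hb : 1 / 2 ≤ b)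
    (hc : a - 1 / 2 ≤ c) (h3 : a ≤ b + c / 2 + 1 / 4) : TwoFThreePositive a b c := by
  obtain ⟨y, hy1, hy2, hy3, hy4⟩ : ∃ y, a + 1 / 2 ≤ y ∧ 2 * a + 1 / 2 - b ≤ y ∧ y ≤ c + b + 1 ∧
      (y = a + 1 / 2 ∨ y = 2 * a + 1 / 2 - b) := by
    rcases le_total (a + 1 / 2) (2 * a + 1 / 2 - b) with h | h
    · exact ⟨_, h, le_rfl, by linarith, Or.inr rfl⟩
    · exact ⟨_, le_rfl, h, by linarith, Or.inl rfl⟩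
  have H := altNonneg_of_two_steps (s := twoFThreeCoeff a b c) (A := a) (u₁ := a + 1 / 2)
    (u₂ := 2 * a) (v₁ := a + b) (v₂ := y) (p₁ := a + 1 / 2) (p₂ := y)
    (q₁ := c + 1) (q₂ := a + b + 1 / 2) (by linarith) (by linarith) (by linarith) (by linarith)
    (by linarith) (by linarith) (by linarith) (by linarith) (by linarith) (by linarith)
    (by linarith) fun k => by
      unfold twoFThreeCoeff pochQuot
      have p1 := (poch_pos (by linarith : 0 < a + 1 / 2) k).ne'
      have p2 := (poch_pos (by linarith : 0 < 2 * a) k).ne'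
      have p3 := (poch_pos (by linarith : 0 < y) k).ne'
      generalize poch (a + 1 / 2) k = X at *
      generalize poch (2 * a) k = Y at *
      generalize poch y k = Z at *
      rw [div_mul_div_comm, div_mul_div_comm,
        ← mul_div_mul_right _ _ (mul_ne_zero (mul_ne_zero p1 p2) p3)]
      congr 1 <;> ring
  refine ⟨H.1, fun hn => H.2 fun ⟨i1, i2⟩ => hn (Or.inr ?_)⟩
  rcases i1 with ⟨i1, i4⟩ | ⟨i1, i4⟩ <;> rcases i2 with ⟨i2, i3⟩ | ⟨i2, i3⟩ <;>
    first
    | linarith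
    | exact ⟨by linarith, by linarith, by linarith⟩

theorem twoFThreePositive_of_le_sub_half {a b c : ℝ} (ha : 1 / 2 ≤ a) (hc : c ≤ a - 1 / 2)
    (h1 : a ≤ c + 1) (h2 : a ≤ b + c) (h3 : a ≤ b / 2 + 3 * c / 4 + 3 / 8) :
    TwoFThreePositive a b c := by
  have H := altNonneg_of_two_steps (s := twoFThreeCoeff a b c) (A := 2 * a - c - 1 / 2)
    (u₁ := 2 * a - c) (u₂ := 4 * a - 2 * c - 1) (v₁ := a + b) (v₂ := a + b + 1 / 2) (p₁ := a)
    (p₂ := a + 1 / 2) (q₁ := 2 * a - c - 1 / 2) (q₂ := c + 1) (by linarith) (by linarith)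
    (by linarith) (by linarith) (by linarith) (by linarith) (by linarith) (by linarith)
    (by linarith) (by linarith) (by linarith) fun k => by
      rw [show 2 * a - c - 1 / 2 + 1 / 2 = 2 * a - c by ring,
        show 2 * (2 * a - c - 1 / 2) = 4 * a - 2 * c - 1 by ring]
      unfold twoFThreeCoeff pochQuot
      have p1 := (poch_pos (by linarith : 0 < 2 * a - c) k).ne'
      have p2 := (poch_pos (by linarith : 0 < 4 * a - 2 * c - 1) k).ne'
      have p3 := (poch_pos (by linarith : 0 < 2 * a - c - 1 / 2) k).ne'
      generalize poch (2 * a - c) k = X at *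
      generalize poch (4 * a - 2 * c - 1) k = Y at *
      generalize poch (2 * a - c - 1 / 2) k = Z at *
      rw [div_mul_div_comm, div_mul_div_comm,
        ← mul_div_mul_right _ _ (mul_ne_zero (mul_ne_zero p1 p2) p3)]
      congr 1 <;> ring
  refine ⟨H.1, fun hn => H.2 fun ⟨i1, i2⟩ => hn ?_⟩
  rcases i1 with ⟨i1, i4⟩ | ⟨i1, i4⟩ <;> rcases i2 with ⟨i2, i3⟩ | ⟨i2, i3⟩ <;>
    first
    | linarith
    | exact Or.inl ⟨by linarith, by linarith, by linarith⟩
    | exact Or.inr ⟨by linarith, by linarith, by linarith⟩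

/-- The parameter region of the positivity theorem for the hypergeometric function. -/
theorem twoFThreePositive {a b c : ℝ} (ha : 0 < a)
    (h : (c ≤ -1 / 2 ∧ a ≤ min (c + 1) (b + c) ∧ 1 / 4 ≤ b) ∨
        (-1 / 2 ≤ c ∧ 1 / 4 ≤ b ∧
          (a ≤ min (1 / 2) (b + c / 2 - 1 / 4) ∨
            (1 / 2 ≤ a ∧
              a ≤ min (c + 1) (min (b + c) (min (b + c / 2 + 1 / 4)
                (min (b / 2 + 3 * c / 4 + 3 / 8) (2 * b + c / 2 - 1 / 4)))))))) :
    TwoFThreePositive a b c := by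
  simp only [le_min_iff] at h
  rcases h with ⟨h1, ⟨h2, h3⟩, h4⟩ | ⟨h1, h2, ⟨h3, h4⟩ | ⟨h3, h4, h5, h6, h7, h8⟩⟩
  · rcases le_or_gt b 1 with hb | hb
    · exact twoFThreePositive_of_le_one ha h4 hb h3 (by linarith)
    · exact .mono ha one_pos hb (twoFThreePositive_of_le_one (b := 1) ha (by norm_num) le_rfl
        (by linarith) (by linarith)).1
  · rcases le_or_gt b 1 with hb | hb
    · exact twoFThreePositive_of_le_one ha h2 hb (by linarith) h4
    · exact .mono ha one_pos hb (twoFThreePositive_of_le_one (b := 1) ha (by norm_num) le_rfl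
        (by linarith) (by linarith)).1
  · rcases le_total b (1 / 2) with hb | hb
    · exact twoFThreePositive_of_b_le_half h3 h2 hb h5 h8
    · rcases le_total c (a - 1 / 2) with hc' | hc'
      · exact twoFThreePositive_of_le_sub_half h3 hc' h4 h5 h7
      · exact twoFThreePositive_of_half_le h3 hb hc' h6

theorem altSeries_besselCoeff_three_halves {x : ℝ} (hx : x ≠ 0) :
    altSeries (besselCoeff (3 / 2)) (x ^ 2) = Real.sin x / x := by
  have key : ∀ k : ℕ, (4 : ℝ) ^ k * (k.factorial * poch (3 / 2) k) = (2 * k + 1).factorial := by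
    intro k
    induction k with
    | zero => simp [poch_zero]
    | succ k ih =>
      rw [show 2 * (k + 1) + 1 = (2 * k + 1) + 1 + 1 by ring, Nat.factorial_succ (2 * k + 1 + 1),
        Nat.factorial_succ (2 * k + 1), Nat.cast_mul, Nat.cast_mul, ← ih, poch_succ,
        Nat.factorial_succ]
      push_cast
      ring
  refine HasSum.tsum_eq ?_
  convert! (Real.hasSum_sin x).div_const x using 2 with k
  rw [besselCoeff, key, neg_pow, ← pow_mul, pow_succ x (2 * k)]
  field_simp

theorem altSeries_besselCoeff_half (x : ℝ) :
    altSeries (besselCoeff (1 / 2)) (x ^ 2) = Real.cos x := by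
  have key : ∀ k : ℕ, (4 : ℝ) ^ k * (k.factorial * poch (1 / 2) k) = (2 * k).factorial := by
    intro k
    induction k with
    | zero => simp [poch_zero]
    | succ k ih =>
      rw [show 2 * (k + 1) = 2 * k + 1 + 1 by ring, Nat.factorial_succ (2 * k + 1),
        Nat.factorial_succ (2 * k), Nat.cast_mul, Nat.cast_mul, ← ih, poch_succ,
        Nat.factorial_succ]
      push_cast
      ring
  refine HasSum.tsum_eq ?_
  convert! Real.hasSum_cos x using 2 with k
  rw [besselCoeff, key, neg_pow, pow_mul]
  ring

theorem altSeries_twoFThreeCoeff_exceptional {a b c : ℝ} (h : IsExceptional a b c) {x : ℝ}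
    (hx : x ≠ 0) : altSeries (twoFThreeCoeff a b c) (x ^ 2) = (Real.sin x / x) ^ 2 := by
  have hsq := altSeries_eq_sq one_pos (x ^ 2)
  rw [show (1 : ℝ) + 1 / 2 = 3 / 2 by norm_num, show (2 : ℝ) * 1 = 2 by norm_num,
    altSeries_besselCoeff_three_halves hx] at hsq
  rw [← hsq]
  congr 1
  funext k
  rcases h with ⟨rfl, rfl, rfl⟩ | ⟨rfl, rfl, rfl⟩
  · unfold twoFThreeCoeff
    rw [show (1 : ℝ) / 2 + 1 / 2 = 1 by norm_num, show (-1 : ℝ) / 2 + 1 = 1 / 2 by norm_num,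
      show (1 : ℝ) / 2 + 1 = 3 / 2 by norm_num, show (3 : ℝ) / 2 + 1 / 2 = 2 by norm_num]
    have p := (poch_pos (by norm_num : (0 : ℝ) < 1 / 2) k).ne'
    generalize poch (1 / 2) k = X at *
    rw [← mul_div_mul_right (poch 1 k) _ p]
    congr 1 <;> ring
  · unfold twoFThreeCoeff
    rw [show (1 : ℝ) + 1 / 2 = 3 / 2 by norm_num, show (1 : ℝ) / 2 + 1 = 3 / 2 by norm_num,
      show (3 : ℝ) / 2 + 1 / 2 = 2 by norm_num]
    have p := (poch_pos (by norm_num : (0 : ℝ) < 3 / 2) k).ne'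
    generalize poch (3 / 2) k = X at *
    rw [← mul_div_mul_right (poch 1 k) _ p]
    congr 1
    ring

theorem integral_sub_rpow_mul_rpow {p q x : ℝ} (hp : 0 < p) (hq : 0 < q) (hx : 0 < x) :
    ∫ t in (0 : ℝ)..x, (x - t) ^ (q - 1) * t ^ (p - 1) =
      x ^ (p + q - 1) * (Real.Gamma p * Real.Gamma q / Real.Gamma (p + q)) := by
  have h := Complex.betaIntegral_scaled p q hx
  rw [Complex.betaIntegral_eq_Gamma_mul_div _ _ (by simpa) (by simpa), ← Complex.ofReal_add,
    Complex.Gamma_ofReal, Complex.Gamma_ofReal, Complex.Gamma_ofReal] at h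
  have e : ∫ t in (0 : ℝ)..x, (t : ℂ) ^ ((p : ℂ) - 1) * ((x : ℂ) - t) ^ ((q : ℂ) - 1) =
      ∫ t in (0 : ℝ)..x, (((x - t) ^ (q - 1) * t ^ (p - 1) : ℝ) : ℂ) := by
    refine intervalIntegral.integral_congr fun t ht => ?_
    rw [uIcc_of_le hx.le] at ht
    rw [Complex.ofReal_mul, Complex.ofReal_cpow (sub_nonneg.2 ht.2), Complex.ofReal_cpow ht.1]
    push_cast
    ring
  rw [e, intervalIntegral.integral_ofReal] at h
  rw [← Complex.ofReal_inj, h]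
  push_cast
  rw [Complex.ofReal_cpow hx.le]
  push_cast
  ring

theorem intervalIntegrable_sub_rpow_mul_rpow {p q x : ℝ} (hp : 0 < p) (hq : 0 < q) (hx : 0 < x) :
    IntervalIntegrable (fun t : ℝ => (x - t) ^ (q - 1) * t ^ (p - 1)) volume 0 x := by
  by_contra hc
  have h := integral_sub_rpow_mul_rpow hp hq hx
  rw [intervalIntegral.integral_undef hc] at h
  have := Real.Gamma_pos_of_pos hp
  have := Real.Gamma_pos_of_pos hq
  have := Real.Gamma_pos_of_pos (add_pos hp hq)
  have : 0 < x ^ (p + q - 1) * (Real.Gamma p * Real.Gamma q / Real.Gamma (p + q)) := by positivity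
  exact this.ne h

theorem besselJ_eq_altSeries {α t : ℝ} (hα : -1 < α) (ht : 0 < t) :
    besselJ α t = (t / 2) ^ α / Real.Gamma (α + 1) * altSeries (besselCoeff (α + 1)) (t ^ 2) := by
  have hc : 0 < α + 1 := by linarith
  have hG := (Real.Gamma_pos_of_pos hc).ne'
  rw [besselJ, altSeries, ← tsum_mul_left]
  refine tsum_congr fun n => ?_
  have hp := (poch_pos hc n).ne'
  rw [add_assoc, Gamma_nat_add hc, Real.rpow_add (by positivity), besselCoeff,
    show (2 * (n : ℝ)) = ((2 * n : ℕ) : ℝ) by push_cast; ring, Real.rpow_natCast, neg_pow (t ^ 2),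
    pow_mul (t / 2), div_pow, div_pow, show (2 : ℝ) ^ 2 = 4 by norm_num]
  field_simp

/-- The integrand in terms of the normalized Bessel function. -/
theorem besselIntegrand_eq {α lam μ x t : ℝ} (hα : -1 < α) (ht : 0 < t) :
    besselIntegrand α lam μ x t = 1 / (2 ^ α * Real.Gamma (α + 1)) *
      ((x - t) ^ lam * t ^ (α + μ) * altSeries (besselCoeff (α + 1)) (t ^ 2)) := by
  rw [besselIntegrand, besselJ_eq_altSeries hα ht, Real.div_rpow ht.le zero_le_two,
    Real.rpow_add ht]
  ring

theorem intervalIntegrable_besselIntegrand {α lam μ x : ℝ} (hα : -1 < α) (hl : -1 < lam)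
    (hμ : -α - 1 < μ) (hx : 0 < x) :
    IntervalIntegrable (besselIntegrand α lam μ x) volume 0 x := by
  have hcont : Continuous fun t : ℝ => altSeries (besselCoeff (α + 1)) (t ^ 2) :=
    (entireCoeff_besselCoeff (by linarith)).continuous.comp (continuous_pow 2)
  have h := ((intervalIntegrable_sub_rpow_mul_rpow (by linarith : 0 < α + μ + 1)
    (by linarith : 0 < lam + 1) hx).mul_continuousOn hcont.continuousOn).const_mul
      (1 / (2 ^ α * Real.Gamma (α + 1)))
  refine h.congr fun t ht => ?_
  rw [uIoc_of_le hx.le] at ht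
  rw [besselIntegrand_eq hα ht.1]
  simp only [add_sub_cancel_right]

/-- The fractional integral as a multiple of a `₂F₃` series. -/
theorem besselIntegral_eq {α lam μ x : ℝ} (hα : -1 < α) (hl : -1 < lam) (hμ : -α - 1 < μ)
    (hx : 0 < x) (hE : EntireCoeff (twoFThreeCoeff ((α + μ + 1) / 2) ((lam + 1) / 2) α)) :
    besselIntegral α lam μ x = 1 / (2 ^ α * Real.Gamma (α + 1)) * (x ^ (α + μ + lam + 1) *
      (Real.Gamma (α + μ + 1) * Real.Gamma (lam + 1) / Real.Gamma (α + μ + lam + 2))) *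
      altSeries (twoFThreeCoeff ((α + μ + 1) / 2) ((lam + 1) / 2) α) ((x / 2) ^ 2) := by
  set D := x ^ (α + μ + lam + 1) *
    (Real.Gamma (α + μ + 1) * Real.Gamma (lam + 1) / Real.Gamma (α + μ + lam + 2)) with hD
  have hp : 0 < α + μ + 1 := by linarith
  have hq : 0 < lam + 1 := by linarith
  have hpq : 0 < α + μ + lam + 2 := by linarith
  have hc : 0 < α + 1 := by linarith
  have hint : ∀ k : ℕ, besselCoeff (α + 1) k *
      ∫ t in (0 : ℝ)..x, (x - t) ^ (lam + 1 - 1) * t ^ (2 * k + (α + μ + 1) - 1) =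
      D * (twoFThreeCoeff ((α + μ + 1) / 2) ((lam + 1) / 2) α k * (x ^ 2 / 4) ^ k) := by
    intro k
    have e1 := Gamma_nat_add hp (2 * k)
    have e2 := Gamma_nat_add hpq (2 * k)
    have e3 := poch_two_mul ((α + μ + 1) / 2) k
    have e4 := poch_two_mul ((α + μ + 1) / 2 + (lam + 1) / 2) k
    rw [show 2 * ((α + μ + 1) / 2) = α + μ + 1 by ring] at e3
    rw [show 2 * ((α + μ + 1) / 2 + (lam + 1) / 2) = α + μ + lam + 2 by ring] at e4
    rw [e3] at e1
    rw [e4] at e2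
    push_cast at e1 e2
    rw [integral_sub_rpow_mul_rpow (by positivity) hq hx, e1,
      show 2 * (k : ℝ) + (α + μ + 1) + (lam + 1) = 2 * k + (α + μ + lam + 2) by ring, e2,
      show 2 * (k : ℝ) + (α + μ + lam + 2) - 1 = (α + μ + lam + 1) + (2 * k : ℕ) by
        push_cast; ring,
      Real.rpow_add hx, Real.rpow_natCast, besselCoeff, twoFThreeCoeff, hD, pow_mul, div_pow]
    have p1 := (poch_pos hc k).ne'
    have p2 := (poch_pos (by linarith : 0 < (α + μ + 1) / 2 + (lam + 1) / 2) k).ne'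
    have p3 := (poch_pos (by linarith : 0 < (α + μ + 1) / 2 + (lam + 1) / 2 + 1 / 2) k).ne'
    have p4 := (Real.Gamma_pos_of_pos hpq).ne'
    generalize poch ((α + μ + 1) / 2 + (lam + 1) / 2) k = X at *
    generalize poch ((α + μ + 1) / 2 + (lam + 1) / 2 + 1 / 2) k = Y at *
    generalize poch (α + 1) k = Z at *
    generalize poch ((α + μ + 1) / 2) k = V at *
    generalize poch ((α + μ + 1) / 2 + 1 / 2) k = W at *
    generalize x ^ (α + μ + lam + 1) = U at *
    field_simp
  have hI : ∀ k : ℕ, IntervalIntegrable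
      (fun t : ℝ => (x - t) ^ (lam + 1 - 1) * t ^ (2 * k + (α + μ + 1) - 1)) volume 0 x :=
    fun k => intervalIntegrable_sub_rpow_mul_rpow (by positivity) hq hx
  have h := hasSum_integral_of_summable_integral_norm (μ := volume.restrict (Ioc (0 : ℝ) x))
    (F := fun k t => besselCoeff (α + 1) k * (-1) ^ k *
      ((x - t) ^ (lam + 1 - 1) * t ^ (2 * k + (α + μ + 1) - 1))) ?_ ?_
  · have e1 : besselIntegral α lam μ x = 1 / (2 ^ α * Real.Gamma (α + 1)) *
        ∫ t in Ioc 0 x, ∑' k : ℕ, besselCoeff (α + 1) k * (-1) ^ k *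
          ((x - t) ^ (lam + 1 - 1) * t ^ (2 * k + (α + μ + 1) - 1)) := by
      rw [besselIntegral, intervalIntegral.integral_of_le hx.le, ← integral_const_mul]
      refine setIntegral_congr_fun measurableSet_Ioc fun t ht => ?_
      rw [besselIntegrand_eq hα ht.1, altSeries, ← tsum_mul_left]
      congr 1
      refine tsum_congr fun k => ?_
      rw [add_sub_cancel_right, show 2 * (k : ℝ) + (α + μ + 1) - 1 = (α + μ) + (2 * k : ℕ) by
        push_cast; ring, Real.rpow_add ht.1 (α + μ), Real.rpow_natCast, neg_pow, pow_mul]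
      ring
    rw [e1, ← h.tsum_eq, mul_assoc]
    congr 1
    rw [altSeries, ← tsum_mul_left]
    refine tsum_congr fun k => ?_
    rw [integral_const_mul, ← intervalIntegral.integral_of_le hx.le, mul_right_comm, hint,
      show -(x / 2) ^ 2 = -1 * (x ^ 2 / 4) by ring, mul_pow]
    ring
  · intro k
    exact ((intervalIntegrable_iff_integrableOn_Ioc_of_le hx.le).1 (hI k)).const_mul _
  · refine Summable.congr ((hE (x ^ 2 / 4) (by positivity)).mul_left D) fun k => ?_
    have hb : 0 < besselCoeff (α + 1) k := by
      have := poch_pos hc k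
      unfold besselCoeff
      positivity
    have : ∫ t in Ioc (0 : ℝ) x, ‖besselCoeff (α + 1) k * (-1) ^ k *
          ((x - t) ^ (lam + 1 - 1) * t ^ (2 * k + (α + μ + 1) - 1))‖
        = ∫ t in Ioc (0 : ℝ) x, besselCoeff (α + 1) k *
          ((x - t) ^ (lam + 1 - 1) * t ^ (2 * k + (α + μ + 1) - 1)) := by
      refine setIntegral_congr_fun measurableSet_Ioc fun t ht => ?_
      simp only [norm_mul, norm_pow, norm_neg, norm_one, one_pow, mul_one, Real.norm_eq_abs]
      rw [abs_of_pos hb, abs_of_nonneg (Real.rpow_nonneg (sub_nonneg.2 ht.2) _),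
        abs_of_nonneg (Real.rpow_nonneg ht.1.le _)]
    rw [this, integral_const_mul, ← intervalIntegral.integral_of_le hx.le, hint, abs_of_pos]
    have := poch_pos (by linarith : 0 < (α + μ + 1) / 2) k
    have := poch_pos (by linarith : 0 < (α + μ + 1) / 2 + 1 / 2) k
    have := poch_pos (by linarith : 0 < (α + μ + 1) / 2 + (lam + 1) / 2) k
    have := poch_pos (by linarith : 0 < (α + μ + 1) / 2 + (lam + 1) / 2 + 1 / 2) k
    have := poch_pos hc k
    unfold twoFThreeCoeff
    positivity

theorem integral_sub_mul_cos (x : ℝ) :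
    ∫ t in (0 : ℝ)..x, (x - t) * Real.cos t = 1 - Real.cos x := by
  have h : ∀ t ∈ uIcc 0 x, HasDerivAt (fun t => (x - t) * Real.sin t - Real.cos t)
      ((x - t) * Real.cos t) t := fun t _ => by
    have := (((hasDerivAt_id t).const_sub x).mul (Real.hasDerivAt_sin t)).sub (Real.hasDerivAt_cos t)
    convert! this using 1
    simp
  rw [intervalIntegral.integral_eq_sub_of_hasDerivAt h
    (by apply Continuous.intervalIntegrable; fun_prop)]
  simp
  ring

theorem besselIntegral_exceptional {α lam μ x : ℝ}
    (h : (α = -1 / 2 ∧ lam = 1 ∧ μ = 1 / 2) ∨ (α = 1 / 2 ∧ lam = 0 ∧ μ = 1 / 2)) (hx : 0 < x) :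
    besselIntegral α lam μ x = Real.sqrt (2 / Real.pi) * (1 - Real.cos x) := by
  have hπ := Real.pi_pos
  have hs : Real.sqrt (2 / Real.pi) = Real.sqrt 2 / Real.sqrt Real.pi :=
    Real.sqrt_div zero_le_two _
  have h2 : Real.sqrt 2 * Real.sqrt 2 = 2 := Real.mul_self_sqrt zero_le_two
  have hsπ : 0 < Real.sqrt Real.pi := Real.sqrt_pos.2 hπ
  have hs2 : 0 < Real.sqrt 2 := Real.sqrt_pos.2 zero_lt_two
  rcases h with ⟨rfl, rfl, rfl⟩ | ⟨rfl, rfl, rfl⟩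
  · rw [← integral_sub_mul_cos, ← intervalIntegral.integral_const_mul, besselIntegral,
      intervalIntegral.integral_of_le hx.le, intervalIntegral.integral_of_le hx.le]
    refine setIntegral_congr_fun measurableSet_Ioc fun t ht => ?_
    rw [besselIntegrand_eq (by norm_num) ht.1, show (-1 : ℝ) / 2 + 1 = 1 / 2 by norm_num,
      show (-1 : ℝ) / 2 + 1 / 2 = 0 by norm_num, altSeries_besselCoeff_half, Real.rpow_one,
      Real.rpow_zero, Real.Gamma_one_half_eq, show (-1 : ℝ) / 2 = -(1 / 2) by norm_num,
      Real.rpow_neg zero_le_two, ← Real.sqrt_eq_rpow, hs]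
    field_simp
  · rw [show 1 - Real.cos x = ∫ t in (0 : ℝ)..x, Real.sin t by simp,
      ← intervalIntegral.integral_const_mul, besselIntegral,
      intervalIntegral.integral_of_le hx.le, intervalIntegral.integral_of_le hx.le]
    refine setIntegral_congr_fun measurableSet_Ioc fun t ht => ?_
    have ht0 := ht.1.ne'
    rw [besselIntegrand_eq (by norm_num) ht.1, Real.Gamma_add_one (by norm_num),
      show (1 : ℝ) / 2 + 1 = 3 / 2 by norm_num, altSeries_besselCoeff_three_halves ht0,
      show (1 : ℝ) / 2 + 1 / 2 = 1 by norm_num, Real.rpow_one,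
      Real.rpow_zero, Real.Gamma_one_half_eq, ← Real.sqrt_eq_rpow, hs]
    field_simp
    rw [sq, h2]

theorem theorem5 :
    -- positivity of the hypergeometric function
    (∀ a b c : ℝ, 0 < a → 0 < b → -1 < c →
      ((c ≤ -1 / 2 ∧ a ≤ min (c + 1) (b + c) ∧ 1 / 4 ≤ b) ∨
        (-1 / 2 ≤ c ∧ 1 / 4 ≤ b ∧
          (a ≤ min (1 / 2) (b + c / 2 - 1 / 4) ∨
            (1 / 2 ≤ a ∧
              a ≤ min (c + 1) (min (b + c) (min (b + c / 2 + 1 / 4)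
                (min (b / 2 + 3 * c / 4 + 3 / 8) (2 * b + c / 2 - 1 / 4)))))))) →
      (∀ x : ℝ, 0 < x →
        0 ≤ hypergeometric23 a (a + 1 / 2) (c + 1) (a + b) (a + b + 1 / 2) (-x ^ 2)) ∧
      (¬ ((a = 1 / 2 ∧ b = 1 ∧ c = -1 / 2) ∨ (a = 1 ∧ b = 1 / 2 ∧ c = 1 / 2)) →
        ∀ x : ℝ, 0 < x →
          0 < hypergeometric23 a (a + 1 / 2) (c + 1) (a + b) (a + b + 1 / 2) (-x ^ 2)) ∧
      (((a = 1 / 2 ∧ b = 1 ∧ c = -1 / 2) ∨ (a = 1 ∧ b = 1 / 2 ∧ c = 1 / 2)) →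
        ∃ x : ℝ, 0 < x ∧
          hypergeometric23 a (a + 1 / 2) (c + 1) (a + b) (a + b + 1 / 2) (-x ^ 2) = 0)) ∧
    -- positivity of the fractional integrals of Bessel functions
    (∀ α lam μ : ℝ, -1 < α →
      ((α ≤ -1 / 2 ∧ -1 / 2 ≤ lam ∧ -α - 1 < μ ∧ μ ≤ min (α + 1) (lam + α)) ∨
        (-1 / 2 ≤ α ∧ -1 / 2 ≤ lam ∧
          ((-α - 1 < μ ∧ μ ≤ min (-α) (lam - 1 / 2)) ∨
            (-α ≤ μ ∧
              μ ≤ min (α + 1) (min (lam + α) (min (lam + 1 / 2)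
                (min (2 * lam + 1 / 2) (1 / 2 * (lam + α + 1 / 2))))))))) →
      (∀ x : ℝ, 0 < x →
        IntervalIntegrable (besselIntegrand α lam μ x) MeasureTheory.volume 0 x ∧
          0 ≤ besselIntegral α lam μ x) ∧
      (¬ ((α = -1 / 2 ∧ lam = 1 ∧ μ = 1 / 2) ∨ (α = 1 / 2 ∧ lam = 0 ∧ μ = 1 / 2)) →
        ∀ x : ℝ, 0 < x → 0 < besselIntegral α lam μ x)) ∧
    -- the two exceptional cases
    (∀ α lam μ : ℝ,
      ((α = -1 / 2 ∧ lam = 1 ∧ μ = 1 / 2) ∨ (α = 1 / 2 ∧ lam = 0 ∧ μ = 1 / 2)) →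
      ∀ x : ℝ, 0 < x →
        besselIntegral α lam μ x
            = Real.sqrt (2 / Real.pi) * ∫ t in (0 : ℝ)..x, (x - t) * Real.cos t ∧
        besselIntegral α lam μ x = Real.sqrt (2 / Real.pi) * ∫ t in (0 : ℝ)..x, Real.sin t ∧
        besselIntegral α lam μ x = 2 * Real.sqrt (2 / Real.pi) * Real.sin (x / 2) ^ 2) := by
  refine ⟨fun a b c ha _ _ h => ?_, fun α lam μ hα h => ?_, fun α lam μ h x hx => ?_⟩
  · have H := twoFThreePositive ha h
    refine ⟨fun x hx => H.1.nonneg _ (by positivity), fun hn x hx => H.2 hn _ (by positivity),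
      fun he => ⟨Real.pi, Real.pi_pos, ?_⟩⟩
    rw [hypergeometric23_eq_altSeries, altSeries_twoFThreeCoeff_exceptional he Real.pi_ne_zero]
    simp
  · have hμ : -α - 1 < μ := by
      rcases h with ⟨-, -, h, -⟩ | ⟨h0, -, ⟨h, -⟩ | ⟨h, -⟩⟩
      · exact h
      · exact h
      · linarith
    have hl : -1 < lam := by
      rcases h with ⟨-, h, -⟩ | ⟨-, h, -⟩ <;> linarith
    have H : TwoFThreePositive ((α + μ + 1) / 2) ((lam + 1) / 2) α := by
      refine twoFThreePositive (by linarith) ?_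
      simp only [le_min_iff] at h ⊢
      rcases h with ⟨h1, h2, -, h3, h4⟩ | ⟨h1, h2, ⟨-, h3, h4⟩ | ⟨h3, h4, h5, h6, h7, h8⟩⟩
      · exact Or.inl ⟨h1, ⟨by linarith, by linarith⟩, by linarith⟩
      · exact Or.inr ⟨h1, by linarith, Or.inl ⟨by linarith, by linarith⟩⟩
      · exact Or.inr ⟨h1, by linarith, Or.inr ⟨by linarith, by linarith, by linarith,
          by linarith, by linarith, by linarith⟩⟩
    have hC : ∀ x : ℝ, 0 < x → 0 < 1 / (2 ^ α * Real.Gamma (α + 1)) * (x ^ (α + μ + lam + 1) *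
        (Real.Gamma (α + μ + 1) * Real.Gamma (lam + 1) / Real.Gamma (α + μ + lam + 2))) := by
      intro x hx
      have := Real.Gamma_pos_of_pos (by linarith : 0 < α + 1)
      have := Real.Gamma_pos_of_pos (by linarith : 0 < α + μ + 1)
      have := Real.Gamma_pos_of_pos (by linarith : 0 < lam + 1)
      have := Real.Gamma_pos_of_pos (by linarith : 0 < α + μ + lam + 2)
      positivity
    refine ⟨fun x hx => ⟨intervalIntegrable_besselIntegrand hα hl hμ hx, ?_⟩, fun hn x hx => ?_⟩
    · rw [besselIntegral_eq hα hl hμ hx H.1.entire]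
      exact mul_nonneg (hC x hx).le (H.1.nonneg _ (by positivity))
    · rw [besselIntegral_eq hα hl hμ hx H.1.entire]
      refine mul_pos (hC x hx) (H.2 (fun he => hn ?_) _ (by positivity))
      rcases he with ⟨h1, h2, h3⟩ | ⟨h1, h2, h3⟩
      · exact Or.inl ⟨h3, by linarith, by linarith⟩
      · exact Or.inr ⟨h3, by linarith, by linarith⟩
  · rw [besselIntegral_exceptional h hx, integral_sub_mul_cos]
    refine ⟨rfl, by simp, ?_⟩
    have h1 := Real.cos_sq (x / 2)
    rw [mul_div_cancel₀ x two_ne_zero] at h1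
    rw [Real.sin_sq, h1]
    ring
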